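/- Let $r,s,m$ be positive integers with $r\not\equiv s \pmod m$ and $\gcd(r,s,m)=1$. For an integer $N\ge 1$ put \[R_N=\{r,r+m,\ldots,r+m(N-1)\},\quad S_N=\{s,s+m,\ldots,s+m(N-1)\},\] \[I_N=\{1,2,\ldots,\max(r,s)+m(N-1)\}\setminus(R_N\cup S_N).\] For $n\ge 0$ let $C_{n,N}$ be the number of partitions of $n$ with all parts in $R_N\cup S_N\cup I_N$ that have more parts in $R_N$ than in $S_N$ (parts counted with multiplicity), divided by the number of all partitions of $n$ with all parts in $R_N\cup S_N\cup I_N$. Write $(a)_N=\prod_{i=0}^{N-1}(a-i)$. Then: 1. For every $N\ge 1$ the limit $\lim_{n\to\infty}C_{n,N}$ exists, the integrals below converge absolutely, and \[\lim_{n\to\infty}C_{n,N}=\frac{\left(\frac rm+N-1\right)_N\left(\frac sm+N-1\right)_N}{(N-1)!\,(N-1)!}\int_0^1 x^{\frac sm-1}(1-x)^{N-1}\left(\int_0^x t^{\frac rm-1}(1-t)^{N-1}\,dt\right)dx.\] 2. If $s=m$, then \[\lim_{N\to\infty}\lim_{n\to\infty}C_{n,N}=\frac1{2^{r/m}}.\]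 -/

import Mathlib

open Filter Topology

namespace PartitionBias

/-- `P_{RSI}(n)`: the partitions of `n` all of whose parts lie in `R ∪ S ∪ I`. -/
def partitionsIn (R S I : Finset ℕ) (n : ℕ) : Finset n.Partition :=
  Finset.univ.filter fun p => ∀ a ∈ p.parts, a ∈ R ∪ S ∪ I

/-- `P_{R>S,I}(n)`: the members of `P_{RSI}(n)` with more parts in `R` than in `S`,
parts being counted with multiplicity. -/
def biasedPartitionsIn (R S I : Finset ℕ) (n : ℕ) : Finset n.Partition :=
  (partitionsIn R S I n).filter fun p =>
    p.parts.countP (fun a => a ∈ S) < p.parts.countP (fun a => a ∈ R)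

/-- The arithmetic progression `{a, a + m, …, a + m (N - 1)}` with `N` terms. -/
def progression (a m N : ℕ) : Finset ℕ :=
  (Finset.range N).image fun i => a + m * i

/-- `I_N`: the remaining integers of `{1, …, max r s + m (N - 1)}` (used for `N ≥ 1`). -/
def remaining (r s m N : ℕ) : Finset ℕ :=
  Finset.Icc 1 (max r s + m * (N - 1)) \ (progression r m N ∪ progression s m N)

/-- The ratio `C_{n,N}`. -/
noncomputable def biasRatio (r s m n N : ℕ) : ℝ :=
  ((biasedPartitionsIn (progression r m N) (progression s m N) (remaining r s m N) n).card : ℝ) /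
    ((partitionsIn (progression r m N) (progression s m N) (remaining r s m N) n).card : ℝ)

/-- The density `t ^ (a / m - 1) * (1 - t) ^ (N - 1)` (used for `N ≥ 1`). -/
noncomputable def betaIntegrand (a m N : ℕ) (t : ℝ) : ℝ :=
  t ^ ((a : ℝ) / m - 1) * (1 - t) ^ (N - 1)

end PartitionBias

namespace PartitionBias

/-! ### Sequences with increments of polynomial order -/

/-! Heuristically, in a large random partition with parts in a fixed finite set, the total
contributed by the part `a` is, after rescaling, a coordinate of a uniform point of a simplex, so
its multiplicity behaves like an exponential variable of rate `a`. "More parts in `R` than in `S`"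
becomes a race between two sums of independent exponentials, whose probability is `raceWeight R S`.

The proof replaces this picture by a recurrence. Removing one part `a ∈ R` together with one part `b
∈ S` preserves the difference of the two counts, so inclusion-exclusion over the absence of `a` and
of `b` gives `biasCount_add`. Asymptotically, `f (n + c) - f n ~ β * n ^ d` forces `f n ~ β / ((d +
1) * c) * n ^ (d + 1)`, here with `c = a + b`. The leading coefficients then obey
`add_mul_raceWeight`, the memoryless first step of the race: `b` rings before `a` with probability
`b / (a + b)`. Induction on the number of parts in `R` and `S` yields
`tendsto_biasCount_div_partCount`.

For a progression `a + m * i`, `i < N`, the sum of exponentials is `-log T / m` with `T` of law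
Beta(a/m, N), which explains the double integral; the formal check expands both sides into the same
alternating sum. When `s = m` that sum collapses to a single Beta value, and Euler's limit for Gamma
gives `2 ^ (-r / m)`. -/

theorem tendsto_div_pow_succ_of_increment_zero {e f : ℕ → ℝ} {c d : ℕ} (hc : 0 < c)
    (h : ∀ n, e (n + c) = e n + f (n + c))
    (hf : Tendsto (fun n : ℕ => f n / (n : ℝ) ^ d) atTop (𝓝 0)) :
    Tendsto (fun n : ℕ => e n / (n : ℝ) ^ (d + 1)) atTop (𝓝 0) := by
  rw [Metric.tendsto_atTop]
  intro ε hε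
  obtain ⟨N₀, hN₀⟩ := (Metric.tendsto_atTop.1 hf) (ε / 2) (by positivity)
  obtain ⟨K, hK0, hK⟩ : ∃ K : ℝ, 0 ≤ K ∧ ∀ n < N₀ + c, |e n| ≤ K :=
    ⟨∑ i ∈ Finset.range (N₀ + c), |e i|, Finset.sum_nonneg fun _ _ => abs_nonneg _, fun n hn =>
      Finset.single_le_sum (f := fun i => |e i|) (fun _ _ => abs_nonneg _)
        (Finset.mem_range.2 hn)⟩
  -- `K` absorbs the initial segment; beyond it the bound propagates because `k ^ (d + 1) + n ^ d ≤
  -- n ^ (d + 1)` for `n = k + c`, `c ≥ 1`.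
  have key : ∀ n : ℕ, |e n| ≤ K + ε / 2 * (n : ℝ) ^ (d + 1) := by
    intro n
    induction n using Nat.strong_induction_on with
    | _ n ih =>
      by_cases hn : n < N₀ + c
      · have : 0 ≤ ε / 2 * (n : ℝ) ^ (d + 1) := by positivity
        linarith [hK n hn]
      · obtain ⟨k, rfl⟩ : ∃ k, n = k + c := ⟨n - c, by omega⟩
        have h1 := hN₀ (k + c) (by omega)
        have hpos : 0 < ((k + c : ℕ) : ℝ) := by exact_mod_cast (by omega : 0 < k + c)
        have hpd : 0 < ((k + c : ℕ) : ℝ) ^ d := pow_pos hpos d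
        rw [Real.dist_eq, sub_zero, abs_div, abs_of_pos hpd, div_lt_iff₀ hpd] at h1
        have h2 := ih k (by omega)
        have h3 : (k : ℝ) ^ (d + 1) + ((k + c : ℕ) : ℝ) ^ d ≤ ((k + c : ℕ) : ℝ) ^ (d + 1) := by
          have h4 : (k : ℝ) ^ d ≤ ((k + c : ℕ) : ℝ) ^ d := by
            gcongr; omega
          have h5 : (1 : ℝ) ≤ c := by exact_mod_cast hc
          have h6 : (0 : ℝ) ≤ k := Nat.cast_nonneg k
          have h7 := mul_le_mul_of_nonneg_right h4 h6
          have h8 := mul_le_mul_of_nonneg_left h5 hpd.le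
          rw [pow_succ, pow_succ]
          have h9 : ((k + c : ℕ) : ℝ) ^ d * ((k + c : ℕ) : ℝ)
              = ((k + c : ℕ) : ℝ) ^ d * k + ((k + c : ℕ) : ℝ) ^ d * c := by
            push_cast; ring
          linarith
        rw [h k]
        have h10 := mul_le_mul_of_nonneg_left h3 (by positivity : 0 ≤ ε / 2)
        have h11 := abs_add_le (e k) (f (k + c))
        linarith
  have hlim : Tendsto (fun n : ℕ => K / (n : ℝ) ^ (d + 1)) atTop (𝓝 0) :=
    tendsto_const_nhds.div_atTop
      ((tendsto_pow_atTop (Nat.succ_ne_zero d)).comp tendsto_natCast_atTop_atTop)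
  obtain ⟨N₁, hN₁⟩ := (Metric.tendsto_atTop.1 hlim) (ε / 2) (by positivity)
  refine ⟨N₁ + 1, fun n hn => ?_⟩
  have hpos : 0 < (n : ℝ) ^ (d + 1) := pow_pos (by exact_mod_cast (by omega : 0 < n)) _
  have h1 := hN₁ n (by omega)
  rw [Real.dist_eq, sub_zero, abs_of_nonneg (by positivity), div_lt_iff₀ hpos] at h1
  rw [Real.dist_eq, sub_zero, abs_div, abs_of_pos hpos, div_lt_iff₀ hpos]
  linarith [key n]

theorem tendsto_pow_succ_sub_div_pow (c d : ℕ) :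
    Tendsto (fun n : ℕ => ((n : ℝ) ^ (d + 1) - ((n : ℝ) - c) ^ (d + 1)) / (n : ℝ) ^ d) atTop
      (𝓝 ((d + 1) * c)) := by
  have hz : Tendsto (fun n : ℕ => 1 - (c : ℝ) / n) atTop (𝓝 1) := by
    simpa using tendsto_const_nhds.sub (tendsto_const_div_atTop_nhds_zero_nat (c : ℝ))
  have hsum : Tendsto (fun n : ℕ => (c : ℝ) * ∑ i ∈ Finset.range (d + 1), (1 - (c : ℝ) / n) ^ i)
      atTop (𝓝 ((c : ℝ) * ∑ i ∈ Finset.range (d + 1), (1 : ℝ) ^ i)) :=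
    (tendsto_finsetSum _ fun i _ => hz.pow i).const_mul _
  have heq : (c : ℝ) * ∑ i ∈ Finset.range (d + 1), (1 : ℝ) ^ i = (d + 1) * c := by
    simp; ring
  rw [heq] at hsum
  refine hsum.congr' ?_
  filter_upwards [eventually_gt_atTop 0] with n hn
  have hn' : (n : ℝ) ≠ 0 := by exact_mod_cast hn.ne'
  have h1 := mul_neg_geom_sum (1 - (c : ℝ) / n) (d + 1)
  have h2 : (n : ℝ) - c = n * (1 - c / n) := by field_simp
  rw [h2, mul_pow, eq_div_iff (pow_ne_zero _ hn')]
  have h3 : (c : ℝ) = n * (1 - (1 - c / n)) := by field_simp; ring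
  calc (c : ℝ) * (∑ i ∈ Finset.range (d + 1), (1 - (c : ℝ) / n) ^ i) * (n : ℝ) ^ d
      = (n * (1 - (1 - c / n))) * (∑ i ∈ Finset.range (d + 1), (1 - (c : ℝ) / n) ^ i) * n ^ d := by
        rw [← h3]
    _ = n ^ (d + 1) * ((1 - (1 - c / n)) * ∑ i ∈ Finset.range (d + 1), (1 - (c : ℝ) / n) ^ i) := by
        ring
    _ = _ := by rw [h1]; ring

/-- A Stolz–Cesàro statement with step `c`: subtracting `κ * n ^ (d + 1)`, whose increment is `κ *
(d + 1) * c * n ^ d` to leading order, reduces to increments of order `o(n ^ d)`. -/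
theorem tendsto_div_pow_succ_of_increment {u v : ℕ → ℝ} {c d : ℕ} {β : ℝ} (hc : 0 < c)
    (h : ∀ n, u (n + c) = u n + v (n + c))
    (hv : Tendsto (fun n : ℕ => v n / (n : ℝ) ^ d) atTop (𝓝 β)) :
    Tendsto (fun n : ℕ => u n / (n : ℝ) ^ (d + 1)) atTop (𝓝 (β / ((d + 1) * c))) := by
  have hc' : (c : ℝ) ≠ 0 := by exact_mod_cast hc.ne'
  have hd' : (d : ℝ) + 1 ≠ 0 := by positivity
  set κ : ℝ := β / ((d + 1) * c) with hκ
  have h0 : Tendsto (fun n : ℕ =>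
      (v n - κ * ((n : ℝ) ^ (d + 1) - ((n : ℝ) - c) ^ (d + 1))) / (n : ℝ) ^ d) atTop (𝓝 0) := by
    have := hv.sub ((tendsto_pow_succ_sub_div_pow c d).const_mul κ)
    have hz : β - κ * ((d + 1) * c) = 0 := by rw [hκ]; field_simp; ring
    rw [hz] at this
    refine this.congr fun n => ?_
    ring
  have h1 := tendsto_div_pow_succ_of_increment_zero (e := fun n => u n - κ * (n : ℝ) ^ (d + 1))
    (f := fun n => v n - κ * ((n : ℝ) ^ (d + 1) - ((n : ℝ) - c) ^ (d + 1))) hc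
    (fun n => by simp only [h n]; push_cast; ring) h0
  have h2 := h1.add_const κ
  rw [zero_add] at h2
  refine h2.congr' ?_
  filter_upwards [eventually_gt_atTop 0] with n hn
  have hn' : (n : ℝ) ≠ 0 := by exact_mod_cast hn.ne'
  field_simp
  ring

theorem tendsto_shift_div_pow {u : ℕ → ℝ} {d : ℕ} {β : ℝ} (c : ℕ)
    (hu : Tendsto (fun n : ℕ => u n / (n : ℝ) ^ d) atTop (𝓝 β)) :
    Tendsto (fun n : ℕ => u n / ((n + c : ℕ) : ℝ) ^ d) atTop (𝓝 β) := by
  have h1 : Tendsto (fun n : ℕ => (n : ℝ) / (n + c)) atTop (𝓝 1) :=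
    tendsto_natCast_div_add_atTop (c : ℝ)
  have h2 := hu.mul (h1.pow d)
  rw [one_pow, mul_one] at h2
  refine h2.congr' ?_
  filter_upwards [eventually_gt_atTop 0] with n hn
  have hn' : (n : ℝ) ≠ 0 := by exact_mod_cast hn.ne'
  have : (n : ℝ) + c ≠ 0 := by positivity
  push_cast
  rw [div_pow]
  field_simp

theorem tendsto_div_pow_of_lt {u : ℕ → ℝ} {d d' : ℕ} {β : ℝ} (hd : d < d')
    (hu : Tendsto (fun n : ℕ => u n / (n : ℝ) ^ d) atTop (𝓝 β)) :
    Tendsto (fun n : ℕ => u n / (n : ℝ) ^ d') atTop (𝓝 0) := by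
  obtain ⟨k, rfl⟩ := Nat.exists_eq_add_of_lt hd
  have h1 : Tendsto (fun n : ℕ => ((n : ℝ) ^ (k + 1))⁻¹) atTop (𝓝 0) :=
    ((tendsto_pow_atTop (Nat.succ_ne_zero k)).comp tendsto_natCast_atTop_atTop).inv_tendsto_atTop
  have h2 := hu.mul h1
  rw [mul_zero] at h2
  refine h2.congr fun n => ?_
  rw [add_assoc, pow_add _ d, ← div_div, div_eq_mul_inv (u n / (n : ℝ) ^ d)]

/-! ### Removing parts from partitions -/

/-- Inserting `a` is a bijection. The predicate `Q` is arbitrary so that the lemma can be applied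
twice, for `b` and then `a`. -/
theorem card_partition_filter_mem (n a : ℕ) (ha : 0 < a) (Q : Multiset ℕ → Prop)
    [DecidablePred fun p : (n + a).Partition => a ∈ p.parts ∧ Q p.parts]
    [DecidablePred fun p : n.Partition => Q (a ::ₘ p.parts)] :
    ((Finset.univ : Finset (n + a).Partition).filter
        fun p => a ∈ p.parts ∧ Q p.parts).card =
      ((Finset.univ : Finset n.Partition).filter fun p => Q (a ::ₘ p.parts)).card := by
  symm
  refine Finset.card_bij
    (fun p _ => ⟨a ::ₘ p.parts, ?_, ?_⟩) ?_ ?_ ?_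
  · intro i hi
    rcases Multiset.mem_cons.1 hi with rfl | hi
    exacts [ha, p.parts_pos hi]
  · rw [Multiset.sum_cons, p.parts_sum, add_comm]
  · intro p hp
    simpa using hp
  · intro p _ q _ hpq
    have := congrArg Nat.Partition.parts hpq
    exact Nat.Partition.ext ((Multiset.cons_inj_right a).1 this)
  · intro q hq
    rw [Finset.mem_filter] at hq
    have hcons := Multiset.cons_erase hq.2.1
    refine ⟨⟨q.parts.erase a, fun hi => q.parts_pos (Multiset.mem_of_mem_erase hi), ?_⟩, ?_, ?_⟩
    · have h1 := q.parts_sum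
      rw [← hcons, Multiset.sum_cons] at h1
      omega
    · simpa [hcons] using hq.2.2
    · exact Nat.Partition.ext hcons

/-- The number of partitions of `n` with all parts in `A`. -/
def partCount (A : Finset ℕ) (n : ℕ) : ℕ :=
  ((Finset.univ : Finset n.Partition).filter fun p => ∀ x ∈ p.parts, x ∈ A).card

/-- The number of partitions of `n` with parts in `R ∪ S ∪ I` whose number of parts in `S` is
less than `δ` plus the number of parts in `R`. -/
def biasCount (R S I : Finset ℕ) (δ n : ℕ) : ℕ :=
  ((Finset.univ : Finset n.Partition).filter fun p =>
    (∀ x ∈ p.parts, x ∈ R ∪ S ∪ I) ∧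
      p.parts.countP (fun a => a ∈ S) < p.parts.countP (fun a => a ∈ R) + δ).card

theorem forall_mem_erase_iff {A : Finset ℕ} {a : ℕ} {t : Multiset ℕ} :
    (∀ x ∈ t, x ∈ A.erase a) ↔ (∀ x ∈ t, x ∈ A) ∧ a ∉ t := by
  constructor
  · intro h
    exact ⟨fun x hx => Finset.mem_of_mem_erase (h x hx),
      fun ha => Finset.notMem_erase a A (h a ha)⟩
  · rintro ⟨h, ha⟩ x hx
    exact Finset.mem_erase.2 ⟨fun e => ha (e ▸ hx), h x hx⟩

theorem countP_mem_erase {A : Finset ℕ} {a : ℕ} {t : Multiset ℕ} (h : a ∉ t) :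
    t.countP (fun x => x ∈ A.erase a) = t.countP (fun x => x ∈ A) := by
  refine Multiset.countP_congr rfl fun x hx => ?_
  have : x ≠ a := fun e => h (e ▸ hx)
  simp [this]

theorem partCount_add {A : Finset ℕ} {a : ℕ} (ha : a ∈ A) (ha0 : 0 < a) (n : ℕ) :
    partCount A (n + a) = partCount A n + partCount (A.erase a) (n + a) := by
  classical
  unfold partCount
  rw [← Finset.card_filter_add_card_filter_not (s := Finset.univ.filter _)
    (fun p : (n + a).Partition => a ∈ p.parts), Finset.filter_filter, Finset.filter_filter]
  congr 1
  · have := card_partition_filter_mem n a ha0 (fun t => ∀ x ∈ t, x ∈ A)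
    simp only [Multiset.mem_cons, forall_eq_or_imp, ha, true_and] at this
    rw [← this]
    congr 1
    ext p
    simp [and_comm]
  · congr 1
    ext p
    simp only [Finset.mem_filter, forall_mem_erase_iff]

theorem card_add_card_inter_filter_not {α : Type*} [DecidableEq α] (T : Finset α)
    (A B : α → Prop) [DecidablePred A] [DecidablePred B] :
    T.card + ((T.filter fun p => ¬B p) ∩ (T.filter fun p => ¬A p)).card =
      (T.filter fun p => A p ∧ B p).card +
        ((T.filter fun p => ¬B p).card + (T.filter fun p => ¬A p).card) := by
  have h1 : (T.filter fun p => ¬B p) ∪ (T.filter fun p => ¬A p) =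
      T.filter fun p => ¬(A p ∧ B p) := by
    ext p
    simp only [Finset.mem_filter, Finset.mem_union]
    tauto
  have h2 := Finset.card_union_add_card_inter (T.filter fun p => ¬B p) (T.filter fun p => ¬A p)
  have h3 := Finset.card_filter_add_card_filter_not (s := T) (fun p => A p ∧ B p)
  rw [h1] at h2
  omega

/-- Partitions containing both `a` and `b` correspond to partitions of `n`, since deleting the pair
lowers both counts by one; those missing `a` or `b` are counted by inclusion-exclusion. The
subtracted term is moved to the left to stay in `ℕ`. -/
theorem biasCount_add {R S I : Finset ℕ} {a b : ℕ} (ha : a ∈ R) (hb : b ∈ S) (ha0 : 0 < a)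
    (hb0 : 0 < b) (hRS : Disjoint R S) (hRI : Disjoint R I) (hSI : Disjoint S I) (δ n : ℕ) :
    biasCount R S I δ (n + a + b) + biasCount (R.erase a) (S.erase b) I δ (n + a + b) =
      biasCount R S I δ n + (biasCount R (S.erase b) I δ (n + a + b) +
        biasCount (R.erase a) S I δ (n + a + b)) := by
  classical
  have haS : a ∉ S := Finset.disjoint_left.1 hRS ha
  have haI : a ∉ I := Finset.disjoint_left.1 hRI ha
  have hbR : b ∉ R := Finset.disjoint_right.1 hRS hb
  have hbI : b ∉ I := Finset.disjoint_left.1 hSI hb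
  have hab : b ≠ a := fun e => hbR (e ▸ ha)
  set Q : Multiset ℕ → Prop := fun t => (∀ x ∈ t, x ∈ R ∪ S ∪ I) ∧
    t.countP (fun a => a ∈ S) < t.countP (fun a => a ∈ R) + δ with hQ
  set T := (Finset.univ : Finset (n + a + b).Partition).filter fun p => Q p.parts with hT
  have e1 : R.erase a ∪ S ∪ I = (R ∪ S ∪ I).erase a := by
    rw [Finset.erase_union_distrib, Finset.erase_union_distrib, Finset.erase_eq_of_notMem haS,
      Finset.erase_eq_of_notMem haI]
  have e2 : R ∪ S.erase b ∪ I = (R ∪ S ∪ I).erase b := by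
    rw [Finset.erase_union_distrib, Finset.erase_union_distrib, Finset.erase_eq_of_notMem hbR,
      Finset.erase_eq_of_notMem hbI]
  have e3 : R.erase a ∪ S.erase b ∪ I = ((R ∪ S ∪ I).erase b).erase a := by
    rw [← e2, Finset.erase_union_distrib, Finset.erase_union_distrib,
      Finset.erase_eq_of_notMem haI,
      Finset.erase_eq_of_notMem (fun h => haS (Finset.mem_of_mem_erase h))]
  have h0 : biasCount R S I δ (n + a + b) = T.card := rfl
  have h1 : biasCount (R.erase a) S I δ (n + a + b) =
      (T.filter fun p => a ∉ p.parts).card := by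
    unfold biasCount
    rw [hT, Finset.filter_filter]
    congr 1
    ext p
    simp only [Finset.mem_filter, Finset.mem_univ, true_and, e1, forall_mem_erase_iff, hQ]
    by_cases hp : a ∈ p.parts
    · simp [hp]
    · simp only [hp, not_false_eq_true, and_true, countP_mem_erase hp]
  have h2 : biasCount R (S.erase b) I δ (n + a + b) =
      (T.filter fun p => b ∉ p.parts).card := by
    unfold biasCount
    rw [hT, Finset.filter_filter]
    congr 1
    ext p
    simp only [Finset.mem_filter, Finset.mem_univ, true_and, e2, forall_mem_erase_iff, hQ]
    by_cases hp : b ∈ p.parts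
    · simp [hp]
    · simp only [hp, not_false_eq_true, and_true, countP_mem_erase hp]
  have h3 : biasCount (R.erase a) (S.erase b) I δ (n + a + b) =
      ((T.filter fun p => b ∉ p.parts) ∩ (T.filter fun p => a ∉ p.parts)).card := by
    unfold biasCount
    rw [hT, Finset.filter_filter, Finset.filter_filter, ← Finset.filter_and]
    congr 1
    ext p
    simp only [Finset.mem_filter, Finset.mem_univ, true_and, e3, forall_mem_erase_iff, hQ]
    by_cases hp : b ∈ p.parts
    · simp [hp]
    · by_cases hp' : a ∈ p.parts
      · simp [hp']
      · simp only [hp, hp', not_false_eq_true, and_true, countP_mem_erase hp,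
          countP_mem_erase hp', and_self]
  have h4 : biasCount R S I δ n = (T.filter fun p => a ∈ p.parts ∧ b ∈ p.parts).card := by
    have k3 : (T.filter fun p => a ∈ p.parts ∧ b ∈ p.parts).card =
        ((Finset.univ : Finset ((n + a) + b).Partition).filter
          fun p => b ∈ p.parts ∧ a ∈ p.parts ∧ Q p.parts).card := by
      rw [hT, Finset.filter_filter]
      congr 1
      ext p
      simp only [Finset.mem_filter, Finset.mem_univ, true_and]
      tauto
    rw [k3, card_partition_filter_mem (n + a) b hb0 (fun t => a ∈ t ∧ Q t)]
    simp only [Multiset.mem_cons, hab.symm, false_or]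
    rw [card_partition_filter_mem n a ha0 (fun t => Q (b ::ₘ t))]
    unfold biasCount
    congr 1
    ext p
    simp only [Finset.mem_filter, Finset.mem_univ, true_and, hQ, Multiset.mem_cons,
      forall_eq_or_imp, Multiset.countP_cons, ha, hb, haS, hbR, Finset.mem_union, or_true, true_or,
      if_true, if_false, add_zero, add_right_comm _ 1 δ, add_lt_add_iff_right]
  rw [h0, h1, h2, h3, h4]
  exact card_add_card_inter_filter_not T _ _

theorem biasCount_empty_right_one (R I : Finset ℕ) (n : ℕ) :
    biasCount R ∅ I 1 n = partCount (R ∪ I) n := by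
  simp [biasCount, partCount]

theorem biasCount_empty_right_zero_add {R I : Finset ℕ} (hRI : Disjoint R I) (n : ℕ) :
    biasCount R ∅ I 0 n + partCount I n = partCount (R ∪ I) n := by
  classical
  unfold biasCount partCount
  rw [← Finset.card_filter_add_card_filter_not
    (s := Finset.univ.filter fun p : n.Partition => ∀ x ∈ p.parts, x ∈ R ∪ I)
    (fun p : n.Partition => 0 < p.parts.countP (fun a => a ∈ R)), Finset.filter_filter,
    Finset.filter_filter]
  congr 2
  · ext p
    simp
  · ext p
    simp only [Finset.mem_filter, Finset.mem_univ, true_and, Multiset.countP_pos, not_exists,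
      not_and, Finset.mem_union]
    constructor
    · exact fun h => ⟨fun x hx => Or.inr (h x hx), fun x hx hR =>
        Finset.disjoint_left.1 hRI hR (h x hx)⟩
    · exact fun h x hx => (h.1 x hx).resolve_left (h.2 x hx)

/-- With no parts in `R`, the condition is impossible (`δ = 0`) or excludes every part of `S` (`δ =
1`), so `S` itself is immaterial. -/
theorem biasCount_empty_left_erase {S I : Finset ℕ} {b : ℕ} (hSI : Disjoint S I)
    {δ : ℕ} (hδ : δ ≤ 1) (n : ℕ) :
    biasCount ∅ (S.erase b) I δ n = biasCount ∅ S I δ n := by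
  unfold biasCount
  congr 1
  ext p
  simp only [Finset.mem_filter, Finset.mem_univ, true_and, Finset.empty_union,
    Finset.notMem_empty]
  have h0 : p.parts.countP (fun _ => False) = 0 := Multiset.countP_eq_zero.2 fun _ _ h => h
  rw [h0, zero_add]
  interval_cases δ
  · simp
  · simp only [Nat.lt_one_iff, Multiset.countP_eq_zero, Finset.mem_union, Finset.mem_erase]
    constructor
    · rintro ⟨h1, h2⟩
      have h3 : ∀ x ∈ p.parts, x ∈ I := fun x hx => (h1 x hx).resolve_left (by simpa using h2 x hx)
      exact ⟨fun x hx => Or.inr (h3 x hx), fun x hx hS =>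
        Finset.disjoint_left.1 hSI hS (h3 x hx)⟩
    · rintro ⟨h1, h2⟩
      exact ⟨fun x hx => Or.inr ((h1 x hx).resolve_left (h2 x hx)), fun x hx h => h2 x hx h.2⟩

theorem biasCount_zero_add_biasCount_one_swap (R S I : Finset ℕ) (n : ℕ) :
    biasCount R S I 0 n + biasCount S R I 1 n = partCount (R ∪ S ∪ I) n := by
  classical
  unfold biasCount partCount
  rw [← Finset.card_filter_add_card_filter_not
    (s := Finset.univ.filter fun p : n.Partition => ∀ x ∈ p.parts, x ∈ R ∪ S ∪ I)
    (fun p : n.Partition =>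
      p.parts.countP (fun a => a ∈ S) < p.parts.countP (fun a => a ∈ R)), Finset.filter_filter,
    Finset.filter_filter]
  congr 2
  ext p
  simp [Finset.union_comm S R]

/-! ### The limiting probability as a rational function of the parts -/

/-- The probability that a sum of independent exponential variables with rates in `R` exceeds such
a sum with rates in `S`, expanded in partial fractions. -/
noncomputable def raceWeight (R S : Finset ℕ) : ℝ :=
  ∑ a ∈ R, (∏ c ∈ R.erase a, (c : ℝ) / (c - a)) * ∏ b ∈ S, (b : ℝ) / (b + a)

@[simp]
theorem raceWeight_empty_left (S : Finset ℕ) : raceWeight ∅ S = 0 := by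
  simp [raceWeight]

/-- Termwise for `i ≠ a`, this is `(a + b) / ((a - i) * (b + i)) = 1 / (a - i) + 1 / (b + i)`; the
term `i = a` involves only the first summand. -/
theorem add_mul_raceWeight {R S : Finset ℕ} {a b : ℕ} (ha : a ∈ R) (hb : b ∈ S) (hb0 : 0 < b) :
    ((a : ℝ) + b) * raceWeight R S =
      b * raceWeight R (S.erase b) + a * raceWeight (R.erase a) S := by
  unfold raceWeight
  rw [← Finset.add_sum_erase R _ ha, ← Finset.add_sum_erase R _ ha, mul_add, mul_add, add_assoc,
    Finset.mul_sum, Finset.mul_sum, Finset.mul_sum, ← Finset.sum_add_distrib]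
  have hb' : (0 : ℝ) < b := by exact_mod_cast hb0
  congr 1
  · rw [← Finset.mul_prod_erase S _ hb]
    have : (b : ℝ) + a ≠ 0 := by positivity
    field_simp
    ring
  · refine Finset.sum_congr rfl fun i hi => ?_
    have hia := Finset.ne_of_mem_erase hi
    have h1 : a ∈ R.erase i := Finset.mem_erase.2 ⟨hia.symm, ha⟩
    rw [← Finset.mul_prod_erase (R.erase i) _ h1, Finset.erase_right_comm,
      ← Finset.mul_prod_erase S _ hb]
    have h2 : (a : ℝ) - i ≠ 0 := sub_ne_zero.2 (by exact_mod_cast hia.symm)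
    have h3 : (b : ℝ) + i ≠ 0 := by positivity
    field_simp
    ring

/-- The Lagrange basis polynomials at the nodes `R` and `-S` sum to `1`; their values at `0` are the
terms of the two weights. -/
theorem raceWeight_add_raceWeight_swap {R S : Finset ℕ} (hR : ∀ x ∈ R, 0 < x)
    (hS : ∀ x ∈ S, 0 < x) (hne : R.Nonempty) :
    raceWeight R S + raceWeight S R = 1 := by
  classical
  set v : ℕ ⊕ ℕ → ℝ := Sum.elim (fun a => (a : ℝ)) (fun b => -(b : ℝ)) with hv
  have hinj : Set.InjOn v (R.disjSum S : Finset (ℕ ⊕ ℕ)) := by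
    rintro (x | x) hx (y | y) hy hxy
    · simpa [hv] using hxy
    · have h1 := hR x (by simpa using hx)
      have h2 := hS y (by simpa using hy)
      have h1' : (0 : ℝ) < x := by exact_mod_cast h1
      have h2' : (0 : ℝ) < y := by exact_mod_cast h2
      simp only [hv, Sum.elim_inl, Sum.elim_inr] at hxy
      linarith
    · have h1 := hS x (by simpa using hx)
      have h2 := hR y (by simpa using hy)
      have h1' : (0 : ℝ) < x := by exact_mod_cast h1
      have h2' : (0 : ℝ) < y := by exact_mod_cast h2
      simp only [hv, Sum.elim_inl, Sum.elim_inr] at hxy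
      linarith
    · simpa [hv] using hxy
  have hne' : (R.disjSum S).Nonempty := by
    obtain ⟨a, ha⟩ := hne
    exact ⟨Sum.inl a, by simpa using ha⟩
  have h := congrArg (Polynomial.eval 0) (Lagrange.sum_basis hinj hne')
  rw [Polynomial.eval_finsetSum, Finset.sum_disjSum, Polynomial.eval_one] at h
  have e1 : ∀ a, (R.disjSum S).erase (Sum.inl a) = (R.erase a).disjSum S := by
    intro a; ext (x | x) <;> simp
  have e2 : ∀ b, (R.disjSum S).erase (Sum.inr b) = R.disjSum (S.erase b) := by
    intro b; ext (x | x) <;> simp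
  rw [← h]
  unfold raceWeight Lagrange.basis Lagrange.basisDivisor
  congr 1
  · refine Finset.sum_congr rfl fun a ha => ?_
    rw [e1, Polynomial.eval_prod, Finset.prod_disjSum]
    congr 1
    · refine Finset.prod_congr rfl fun c hc => ?_
      simp only [hv, Sum.elim_inl, Polynomial.eval_mul, Polynomial.eval_C, Polynomial.eval_sub,
        Polynomial.eval_X]
      rw [← neg_sub (a : ℝ) c, div_neg, div_eq_mul_inv]
      ring
    · refine Finset.prod_congr rfl fun c hc => ?_
      simp only [hv, Sum.elim_inl, Sum.elim_inr, Polynomial.eval_mul, Polynomial.eval_C,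
        Polynomial.eval_sub, Polynomial.eval_X]
      rw [sub_neg_eq_add, sub_neg_eq_add, zero_add, div_eq_mul_inv, add_comm (a : ℝ), mul_comm]
  · refine Finset.sum_congr rfl fun b hb => ?_
    rw [e2, Polynomial.eval_prod, Finset.prod_disjSum, mul_comm]
    congr 1
    · refine Finset.prod_congr rfl fun c hc => ?_
      simp only [hv, Sum.elim_inl, Sum.elim_inr, Polynomial.eval_mul, Polynomial.eval_C,
        Polynomial.eval_sub, Polynomial.eval_X]
      rw [← neg_add', inv_neg, zero_sub, neg_mul_neg, div_eq_mul_inv, add_comm (b : ℝ), mul_comm]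
    · refine Finset.prod_congr rfl fun c hc => ?_
      simp only [hv, Sum.elim_inr, Polynomial.eval_mul, Polynomial.eval_C, Polynomial.eval_sub,
        Polynomial.eval_X]
      rw [sub_neg_eq_add, zero_sub, neg_neg, div_eq_mul_inv, mul_comm, neg_add_eq_sub]

theorem raceWeight_empty_right {R : Finset ℕ} (hR : ∀ x ∈ R, 0 < x) (hne : R.Nonempty) :
    raceWeight R ∅ = 1 := by
  simpa using raceWeight_add_raceWeight_swap hR (S := ∅) (by simp) hne

/-! ### Asymptotics of the counting functions -/

theorem partCount_empty_succ (n : ℕ) : partCount ∅ (n + 1) = 0 := by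
  unfold partCount
  rw [Finset.card_eq_zero, Finset.filter_eq_empty_iff]
  intro p _ h
  have h0 : p.parts = 0 := Multiset.eq_zero_of_forall_notMem fun x hx => by simpa using h x hx
  have := p.parts_sum
  rw [h0] at this
  simp at this

theorem partCount_zero (A : Finset ℕ) : partCount A 0 = 1 := by
  simp [partCount]

theorem partCount_singleton_one (n : ℕ) : partCount {1} n = 1 := by
  induction n with
  | zero => exact partCount_zero _
  | succ n ih =>
    rw [partCount_add (Finset.mem_singleton_self 1) one_pos, ih, Finset.erase_singleton,
      partCount_empty_succ]

/-- The part `1` is never erased: it rules out periodic behaviour and leaves `{1}` as the base case.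
-/
theorem tendsto_partCount_div_pow (d : ℕ) : ∀ {A : Finset ℕ}, (∀ x ∈ A, 0 < x) → 1 ∈ A →
    A.card = d + 1 → Tendsto (fun n : ℕ => (partCount A n : ℝ) / (n : ℝ) ^ d) atTop
      (𝓝 (1 / (d.factorial * ∏ a ∈ A, (a : ℝ)))) := by
  induction d with
  | zero =>
    intro A _ h1 hc
    obtain ⟨x, rfl⟩ := Finset.card_eq_one.1 hc
    obtain rfl := Finset.mem_singleton.1 h1
    simp [partCount_singleton_one]
  | succ d ih =>
    intro A hA h1 hc
    obtain ⟨a, ha, ha1⟩ := Finset.exists_mem_ne (by omega : 1 < A.card) 1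
    have h2 := ih (A := A.erase a) (fun x hx => hA x (Finset.mem_of_mem_erase hx))
      (Finset.mem_erase.2 ⟨ha1.symm, h1⟩) (by rw [Finset.card_erase_of_mem ha]; omega)
    have h3 := tendsto_div_pow_succ_of_increment (u := fun n => (partCount A n : ℝ)) (hA a ha)
      (fun n => by rw [partCount_add ha (hA a ha)]; push_cast; rfl) h2
    convert h3 using 2
    rw [← Finset.mul_prod_erase A _ ha, Nat.factorial_succ]
    push_cast
    rw [div_div]
    ring

/-- `I` may lack `1`, so its own asymptotics need not exist; the count is instead a difference of
two values for `insert a I` with equal leading terms. -/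
theorem tendsto_partCount_div_pow_card {I : Finset ℕ} {a : ℕ} (hI : ∀ x ∈ I, 0 < x)
    (ha0 : 0 < a) (ha : a ∉ I) (h1 : 1 ∈ insert a I) :
    Tendsto (fun n : ℕ => (partCount I n : ℝ) / (n : ℝ) ^ I.card) atTop (𝓝 0) := by
  have h2 := tendsto_partCount_div_pow I.card (A := insert a I)
    (by simpa [ha0] using hI) h1 (Finset.card_insert_of_notMem ha)
  have h3 := ((tendsto_add_atTop_iff_nat a).2 h2).sub (tendsto_shift_div_pow a h2)
  rw [sub_self] at h3
  refine (tendsto_add_atTop_iff_nat a).1 (h3.congr fun n => ?_)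
  rw [partCount_add (Finset.mem_insert_self a I) ha0, Finset.erase_insert ha]
  push_cast
  ring

theorem tendsto_biasCount_empty_right {R I : Finset ℕ} {d δ : ℕ} (hR : ∀ x ∈ R, 0 < x)
    (hI : ∀ x ∈ I, 0 < x) (hRI : Disjoint R I) (hne : R.Nonempty) (h1 : 1 ∈ R ∪ I) (hδ : δ ≤ 1)
    (hd : R.card + I.card = d + 1) :
    Tendsto (fun n : ℕ => (biasCount R ∅ I δ n : ℝ) / (n : ℝ) ^ d) atTop
      (𝓝 (1 / (d.factorial * ((∏ a ∈ R, (a : ℝ)) * ∏ a ∈ I, (a : ℝ))))) := by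
  have h2 := tendsto_partCount_div_pow d (A := R ∪ I)
    (fun x hx => (Finset.mem_union.1 hx).elim (hR x) (hI x)) h1
    (by rw [Finset.card_union_of_disjoint hRI, hd])
  rw [Finset.prod_union hRI] at h2
  interval_cases δ
  · obtain ⟨a, ha, h1a⟩ : ∃ a ∈ R, 1 ∈ insert a I := by
      rcases Finset.mem_union.1 h1 with h | h
      · exact ⟨1, h, Finset.mem_insert_self 1 I⟩
      · obtain ⟨a, ha⟩ := hne
        exact ⟨a, ha, Finset.mem_insert_of_mem h⟩
    have h3 := tendsto_partCount_div_pow_card hI (hR a ha) (Finset.disjoint_left.1 hRI ha) h1a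
    have h4 : Tendsto (fun n : ℕ => (partCount I n : ℝ) / (n : ℝ) ^ d) atTop (𝓝 0) := by
      have hpos := hne.card_pos
      rcases (by omega : I.card ≤ d).eq_or_lt with h | h
      · rwa [← h]
      · exact tendsto_div_pow_of_lt h h3
    have h5 := h2.sub h4
    rw [sub_zero] at h5
    refine h5.congr fun n => ?_
    rw [← biasCount_empty_right_zero_add hRI]
    push_cast
    ring
  · simpa only [biasCount_empty_right_one] using h2

/-- The recursion can exhaust `S`, so `1` must lie in `R ∪ I` to survive. Both values of `δ` are
needed because the case `1 ∈ S` is later reached by complementation. -/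
theorem tendsto_biasCount_div_pow {I : Finset ℕ} {δ : ℕ} (hI : ∀ x ∈ I, 0 < x) (hδ : δ ≤ 1)
    (k : ℕ) : ∀ {R S : Finset ℕ} {d : ℕ}, R.card + S.card = k → (∀ x ∈ R, 0 < x) →
      (∀ x ∈ S, 0 < x) → Disjoint R S → Disjoint R I → Disjoint S I → R.Nonempty → 1 ∈ R ∪ I →
      R.card + S.card + I.card = d + 1 →
      Tendsto (fun n : ℕ => (biasCount R S I δ n : ℝ) / (n : ℝ) ^ d) atTop
        (𝓝 (raceWeight R S / (d.factorial *
          ((∏ a ∈ R, (a : ℝ)) * (∏ a ∈ S, (a : ℝ)) * ∏ a ∈ I, (a : ℝ))))) := by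
  induction k using Nat.strong_induction_on with
  | _ k ih =>
  intro R S d hk hR hS hRS hRI hSI hne h1 hd
  have hRpos := hne.card_pos
  rcases S.eq_empty_or_nonempty with rfl | ⟨b, hb⟩
  · rw [raceWeight_empty_right hR hne, Finset.prod_empty, mul_one]
    exact tendsto_biasCount_empty_right hR hI hRI hne h1 hδ (by simpa using hd)
  have hSpos := Finset.card_pos.2 ⟨b, hb⟩
  obtain ⟨e, rfl⟩ : ∃ e, d = e + 1 := ⟨d - 1, by omega⟩
  have hSb : (S.erase b).card = S.card - 1 := Finset.card_erase_of_mem hb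
  have hS' : ∀ x ∈ S.erase b, 0 < x := fun x hx => hS x (Finset.mem_of_mem_erase hx)
  have hb0 : (b : ℝ) ≠ 0 := by exact_mod_cast (hS b hb).ne'
  have t1 := ih (R.card + (S.erase b).card) (by omega) (d := e) rfl hR hS'
    (hRS.mono_right (Finset.erase_subset _ _)) hRI (hSI.mono_left (Finset.erase_subset _ _)) hne h1
    (by omega)
  -- If `R = {a}`, possibly with `a = 1`, the two terms with `R` emptied cancel; otherwise some `a ≠
  -- 1` can be erased.
  rcases (by omega : R.card = 1 ∨ 1 < R.card) with hR1 | hR1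
  · obtain ⟨a, rfl⟩ := Finset.card_eq_one.1 hR1
    have ha := Finset.mem_singleton_self a
    have ha0 : (a : ℝ) ≠ 0 := by exact_mod_cast (hR a ha).ne'
    have h2 := tendsto_div_pow_succ_of_increment (u := fun n => (biasCount {a} S I δ n : ℝ))
      (c := a + b) (by have := hR a ha; omega) (fun n => by
        have h3 := biasCount_add ha hb (hR a ha) (hS b hb) hRS hRI hSI δ n
        rw [Finset.erase_singleton, biasCount_empty_left_erase hSI hδ, add_assoc n a b] at h3
        have h4 : biasCount {a} S I δ (n + (a + b)) =
          biasCount {a} S I δ n + biasCount {a} (S.erase b) I δ (n + (a + b)) := by omega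
        rw [h4]
        push_cast
        rfl) t1
    convert h2 using 2
    have h5 := add_mul_raceWeight ha hb (hS b hb)
    rw [Finset.erase_singleton, raceWeight_empty_left, mul_zero, add_zero] at h5
    have hab : (a : ℝ) + b ≠ 0 := by positivity
    rw [← Finset.mul_prod_erase S _ hb, Nat.factorial_succ, eq_div_of_mul_eq hab ((mul_comm _ _).trans h5)]
    push_cast
    field_simp
  · obtain ⟨a, ha, ha1⟩ := Finset.exists_mem_ne hR1 1
    have ha0 : (a : ℝ) ≠ 0 := by exact_mod_cast (hR a ha).ne'
    obtain ⟨g, rfl⟩ : ∃ g, e = g + 1 := ⟨e - 1, by omega⟩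
    have hRa : (R.erase a).card = R.card - 1 := Finset.card_erase_of_mem ha
    have hR' : ∀ x ∈ R.erase a, 0 < x := fun x hx => hR x (Finset.mem_of_mem_erase hx)
    have hne' : (R.erase a).Nonempty := Finset.card_pos.1 (by omega)
    have h1' : 1 ∈ R.erase a ∪ I := by
      rcases Finset.mem_union.1 h1 with h | h
      · exact Finset.mem_union_left _ (Finset.mem_erase.2 ⟨ha1.symm, h⟩)
      · exact Finset.mem_union_right _ h
    have t2 := ih ((R.erase a).card + S.card) (by omega) (d := g + 1) rfl hR' hS
      (hRS.mono_left (Finset.erase_subset _ _)) (hRI.mono_left (Finset.erase_subset _ _)) hSI hne'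
      h1' (by omega)
    have t3 := tendsto_div_pow_of_lt (Nat.lt_add_one g)
      (ih ((R.erase a).card + (S.erase b).card) (by omega) (d := g) rfl hR' hS'
      (hRS.mono (Finset.erase_subset _ _) (Finset.erase_subset _ _))
      (hRI.mono_left (Finset.erase_subset _ _)) (hSI.mono_left (Finset.erase_subset _ _)) hne'
      h1' (by omega))
    have t4 := (t1.add t2).sub t3
    have h2 := tendsto_div_pow_succ_of_increment (u := fun n => (biasCount R S I δ n : ℝ))
      (d := g + 1) (v := fun n => (biasCount R (S.erase b) I δ n : ℝ) + biasCount (R.erase a) S I δ n -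
        biasCount (R.erase a) (S.erase b) I δ n)
      (c := a + b) (by have := hR a ha; omega) (fun n => by
        have h3 := biasCount_add ha hb (hR a ha) (hS b hb) hRS hRI hSI δ n
        rw [add_assoc n a b] at h3
        have h4 : (biasCount R S I δ (n + (a + b)) : ℝ) +
            biasCount (R.erase a) (S.erase b) I δ (n + (a + b)) = biasCount R S I δ n +
            (biasCount R (S.erase b) I δ (n + (a + b)) +
            biasCount (R.erase a) S I δ (n + (a + b))) := by exact_mod_cast h3
        linarith) (t4.congr fun n => by ring)
    convert h2 using 2
    have h5 := add_mul_raceWeight ha hb (hS b hb)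
    have hab : (a : ℝ) + b ≠ 0 := by positivity
    rw [eq_div_of_mul_eq hab ((mul_comm _ _).trans h5), sub_zero,
      ← Finset.mul_prod_erase S _ hb, ← Finset.mul_prod_erase R _ ha, Nat.factorial_succ (g + 1)]
    push_cast
    field_simp

theorem tendsto_biasCount_div_partCount {R S I : Finset ℕ} (hR : ∀ x ∈ R, 0 < x)
    (hS : ∀ x ∈ S, 0 < x) (hI : ∀ x ∈ I, 0 < x) (hRS : Disjoint R S) (hRI : Disjoint R I)
    (hSI : Disjoint S I) (hRne : R.Nonempty) (hSne : S.Nonempty) (h1 : 1 ∈ R ∪ S ∪ I) :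
    Tendsto (fun n : ℕ => (biasCount R S I 0 n : ℝ) / partCount (R ∪ S ∪ I) n) atTop
      (𝓝 (raceWeight R S)) := by
  have hRpos := hRne.card_pos
  obtain ⟨d, hd⟩ : ∃ d, R.card + S.card + I.card = d + 1 :=
    ⟨R.card + S.card + I.card - 1, by omega⟩
  have hRSI : Disjoint (R ∪ S) I := Finset.disjoint_union_left.2 ⟨hRI, hSI⟩
  have hpos : ∀ x ∈ R ∪ S ∪ I, 0 < x := fun x hx => by
    simp only [Finset.mem_union] at hx
    rcases hx with (hx | hx) | hx
    exacts [hR x hx, hS x hx, hI x hx]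
  have hp := tendsto_partCount_div_pow d hpos h1
    (by rw [Finset.card_union_of_disjoint hRSI, Finset.card_union_of_disjoint hRS, hd])
  rw [Finset.prod_union hRSI, Finset.prod_union hRS] at hp
  set D : ℝ := (d.factorial * ((∏ a ∈ R, (a : ℝ)) * (∏ a ∈ S, (a : ℝ)) * ∏ a ∈ I, (a : ℝ))) with hD
  have hD0 : D ≠ 0 := by
    have h : ∀ A : Finset ℕ, (∀ x ∈ A, 0 < x) → ∏ a ∈ A, (a : ℝ) ≠ 0 := fun A hA =>
      Finset.prod_ne_zero_iff.2 fun a ha => by exact_mod_cast (hA a ha).ne'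
    exact mul_ne_zero (by exact_mod_cast d.factorial_ne_zero)
      (mul_ne_zero (mul_ne_zero (h R hR) (h S hS)) (h I hI))
  have hb : Tendsto (fun n : ℕ => (biasCount R S I 0 n : ℝ) / (n : ℝ) ^ d) atTop
      (𝓝 (raceWeight R S / D)) := by
    -- When `1 ∈ S`, swap the roles: count the complement, where `S` has at least as many parts as
    -- `R`.
    by_cases h : 1 ∈ R ∪ I
    · exact tendsto_biasCount_div_pow hI zero_le_one _ rfl hR hS hRS hRI hSI hRne h hd
    · have h' : 1 ∈ S ∪ I := by
        simp only [Finset.mem_union] at h h1 ⊢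
        tauto
      have h2 := tendsto_biasCount_div_pow hI le_rfl _ rfl hS hR hRS.symm hSI hRI hSne h'
        (by rw [add_comm S.card, hd])
      rw [mul_comm (∏ a ∈ S, (a : ℝ)), ← hD] at h2
      have h3 := hp.sub h2
      rw [← sub_div, ← eq_sub_of_add_eq (raceWeight_add_raceWeight_swap hR hS hRne)] at h3
      refine h3.congr fun n => ?_
      rw [← biasCount_zero_add_biasCount_one_swap]
      push_cast
      ring
  have h4 := hb.div hp (one_div_ne_zero hD0)
  have h5 : raceWeight R S / D / (1 / D) = raceWeight R S := by field_simp
  rw [h5] at h4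
  refine h4.congr' ?_
  filter_upwards [eventually_gt_atTop 0] with n hn
  have hn' : (n : ℝ) ^ d ≠ 0 := pow_ne_zero _ (by exact_mod_cast hn.ne')
  exact div_div_div_cancel_right₀ hn' _ _

/-! ### Beta integrals -/

theorem intervalIntegrable_rpow_mul_one_sub_pow {α : ℝ} (hα : 0 < α) (n : ℕ) (a b : ℝ) :
    IntervalIntegrable (fun x : ℝ => x ^ (α - 1) * (1 - x) ^ n) MeasureTheory.volume a b :=
  (intervalIntegral.intervalIntegrable_rpow' (by linarith)).mul_continuousOn (by fun_prop)

theorem integral_rpow_mul_one_sub_pow {α : ℝ} (hα : 0 < α) (n : ℕ) :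
    ∫ x in (0 : ℝ)..1, x ^ (α - 1) * (1 - x) ^ n =
      n.factorial / ∏ j ∈ Finset.range (n + 1), (α + j) := by
  have h := Complex.betaIntegral_eval_nat_add_one_right (u := (α : ℂ)) (by simpa using hα) n
  have h2 : Complex.betaIntegral α (n + 1) =
      ((∫ x in (0 : ℝ)..1, x ^ (α - 1) * (1 - x) ^ n : ℝ) : ℂ) := by
    rw [Complex.betaIntegral, ← intervalIntegral.integral_ofReal]
    refine intervalIntegral.integral_congr fun x hx => ?_
    rw [Set.uIcc_of_le zero_le_one] at hx
    simp only [add_sub_cancel_right, Complex.cpow_natCast]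
    rw [Complex.ofReal_mul, Complex.ofReal_cpow hx.1]
    push_cast
    rfl
  rw [h2] at h
  exact_mod_cast h

theorem rpow_sub_one_mul_pow {x : ℝ} (hx : 0 < x) (α : ℝ) (i : ℕ) :
    x ^ (α - 1) * x ^ i = x ^ (α + i - 1) := by
  rw [← Real.rpow_natCast, ← Real.rpow_add hx]
  ring_nf

theorem one_sub_pow_eq_sum (x : ℝ) (n : ℕ) :
    (1 - x) ^ n = ∑ i ∈ Finset.range (n + 1), (-1) ^ i * (n.choose i : ℝ) * x ^ i := by
  rw [sub_eq_neg_add, add_pow]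
  refine Finset.sum_congr rfl fun i _ => ?_
  rw [neg_pow]
  ring

theorem rpow_sub_one_mul_one_sub_pow {x : ℝ} (hx : 0 < x) (α : ℝ) (n : ℕ) :
    x ^ (α - 1) * (1 - x) ^ n =
      ∑ i ∈ Finset.range (n + 1), (-1) ^ i * (n.choose i : ℝ) * x ^ (α + i - 1) := by
  rw [one_sub_pow_eq_sum, Finset.mul_sum]
  refine Finset.sum_congr rfl fun i _ => ?_
  rw [← rpow_sub_one_mul_pow hx]
  ring

theorem integral_rpow_mul_one_sub_pow_incomplete {α x : ℝ} (hα : 0 < α) (hx : 0 ≤ x) (n : ℕ) :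
    ∫ t in (0 : ℝ)..x, t ^ (α - 1) * (1 - t) ^ n =
      ∑ i ∈ Finset.range (n + 1), (-1) ^ i * (n.choose i : ℝ) / (α + i) * x ^ (α + i) := by
  have h1 : ∫ t in (0 : ℝ)..x, t ^ (α - 1) * (1 - t) ^ n = ∫ t in (0 : ℝ)..x,
      ∑ i ∈ Finset.range (n + 1), (-1) ^ i * (n.choose i : ℝ) * t ^ (α + i - 1) := by
    refine intervalIntegral.integral_congr_ae (Eventually.of_forall fun t ht => ?_)
    rw [Set.uIoc_of_le hx] at ht
    exact rpow_sub_one_mul_one_sub_pow ht.1 α n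
  have hpos : ∀ i : ℕ, 0 < α + i := fun i => by positivity
  rw [h1, intervalIntegral.integral_finsetSum fun i _ =>
    (intervalIntegral.intervalIntegrable_rpow' (by linarith [hpos i])).const_mul _]
  refine Finset.sum_congr rfl fun i _ => ?_
  rw [intervalIntegral.integral_const_mul, integral_rpow (Or.inl (by linarith [hpos i])),
    sub_add_cancel, Real.zero_rpow (hpos i).ne', sub_zero]
  ring

/-- Only the inner power of `1 - t` is expanded, so that each outer term remains a complete Beta
integral. -/
theorem integral_beta_mul_incomplete {α β : ℝ} (hα : 0 < α) (hβ : 0 < β) (n : ℕ) :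
    ∫ x in (0 : ℝ)..1, x ^ (β - 1) * (1 - x) ^ n * ∫ t in (0 : ℝ)..x, t ^ (α - 1) * (1 - t) ^ n =
      n.factorial * ∑ i ∈ Finset.range (n + 1), (-1) ^ i * (n.choose i : ℝ) /
        ((α + i) * ∏ j ∈ Finset.range (n + 1), (α + β + i + j)) := by
  have h1 : ∫ x in (0 : ℝ)..1, x ^ (β - 1) * (1 - x) ^ n *
        ∫ t in (0 : ℝ)..x, t ^ (α - 1) * (1 - t) ^ n =
      ∫ x in (0 : ℝ)..1, ∑ i ∈ Finset.range (n + 1), (-1) ^ i * (n.choose i : ℝ) / (α + i) *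
        (x ^ (α + β + i - 1) * (1 - x) ^ n) := by
    refine intervalIntegral.integral_congr_ae (Eventually.of_forall fun x hx => ?_)
    rw [Set.uIoc_of_le zero_le_one] at hx
    rw [integral_rpow_mul_one_sub_pow_incomplete hα hx.1.le, Finset.mul_sum]
    refine Finset.sum_congr rfl fun i _ => ?_
    have h2 : x ^ (α + β + i - 1) = x ^ (β - 1) * x ^ (α + i) := by
      rw [← Real.rpow_add hx.1]
      ring_nf
    rw [h2]
    ring
  have hpos : ∀ i : ℕ, 0 < α + β + i := fun i => by positivity
  rw [h1, intervalIntegral.integral_finsetSum fun i _ =>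
    (intervalIntegrable_rpow_mul_one_sub_pow (hpos i) n 0 1).const_mul _, Finset.mul_sum]
  refine Finset.sum_congr rfl fun i _ => ?_
  rw [intervalIntegral.integral_const_mul, integral_rpow_mul_one_sub_pow (hpos i), div_mul_div_comm]
  ring

/-- The alternating binomial sum of the Beta values `B(α + i, k + 1)` is `B(α, n + k + 1)`. -/
theorem sum_choose_mul_factorial_div_prod {α : ℝ} (hα : 0 < α) (n k : ℕ) :
    ∑ i ∈ Finset.range (n + 1), (-1) ^ i * (n.choose i : ℝ) *
        (k.factorial / ∏ j ∈ Finset.range (k + 1), (α + i + j)) =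
      (n + k).factorial / ∏ j ∈ Finset.range (n + k + 1), (α + j) := by
  have hpos : ∀ i : ℕ, 0 < α + i := fun i => by positivity
  rw [← integral_rpow_mul_one_sub_pow hα]
  have h1 : ∫ x in (0 : ℝ)..1, x ^ (α - 1) * (1 - x) ^ (n + k) =
      ∫ x in (0 : ℝ)..1, ∑ i ∈ Finset.range (n + 1), (-1) ^ i * (n.choose i : ℝ) *
        (x ^ (α + i - 1) * (1 - x) ^ k) := by
    refine intervalIntegral.integral_congr_ae (Eventually.of_forall fun x hx => ?_)
    rw [Set.uIoc_of_le zero_le_one] at hx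
    rw [pow_add, ← mul_assoc, rpow_sub_one_mul_one_sub_pow hx.1, Finset.sum_mul]
    exact Finset.sum_congr rfl fun i _ => mul_assoc _ _ _
  rw [h1, intervalIntegral.integral_finsetSum fun i _ =>
    (intervalIntegrable_rpow_mul_one_sub_pow (hpos i) k 0 1).const_mul _]
  refine Finset.sum_congr rfl fun i _ => ?_
  rw [intervalIntegral.integral_const_mul, integral_rpow_mul_one_sub_pow (hpos i)]

/-! ### The weight of two arithmetic progressions -/

theorem prod_range_erase_sub {i n : ℕ} (hi : i ≤ n) :
    ∏ j ∈ (Finset.range (n + 1)).erase i, ((j : ℝ) - i) =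
      (-1) ^ i * (i.factorial * (n - i).factorial) := by
  induction n, hi using Nat.le_induction with
  | base =>
    rw [Finset.range_add_one, Finset.erase_insert Finset.notMem_range_self, Nat.sub_self,
      Nat.factorial_zero, Nat.cast_one, mul_one, ← Finset.prod_range_add_one_eq_factorial,
      ← Finset.prod_range_reflect, Nat.cast_prod]
    have : (-1 : ℝ) ^ i = ∏ _j ∈ Finset.range i, (-1 : ℝ) := by simp
    rw [this, ← Finset.prod_mul_distrib]
    refine Finset.prod_congr rfl fun j hj => ?_
    rw [Finset.mem_range] at hj
    obtain ⟨k, rfl⟩ := Nat.exists_eq_add_of_lt hj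
    rw [show j + k + 1 - 1 - j = k by omega]
    push_cast
    ring
  | succ n hn ih =>
    rw [Finset.range_add_one, Finset.erase_insert_of_ne (by omega), Finset.prod_insert (by simp),
      ih, Nat.succ_sub hn, Nat.factorial_succ]
    push_cast [Nat.cast_sub hn]
    ring

theorem progression_injective (a : ℕ) {m : ℕ} (hm : 0 < m) :
    Function.Injective fun i => a + m * i := fun i j h => by
  simpa [hm.ne'] using h

theorem raceWeight_progression {r s m : ℕ} (hr : 0 < r) (hs : 0 < s) (hm : 0 < m) (n : ℕ) :
    raceWeight (progression r m (n + 1)) (progression s m (n + 1)) =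
      (∏ j ∈ Finset.range (n + 1), ((r : ℝ) / m + j)) *
        (∏ j ∈ Finset.range (n + 1), ((s : ℝ) / m + j)) / n.factorial *
        ∑ i ∈ Finset.range (n + 1), (-1) ^ i * (n.choose i : ℝ) / (((r : ℝ) / m + i) *
          ∏ j ∈ Finset.range (n + 1), ((r : ℝ) / m + (s : ℝ) / m + i + j)) := by
  have hm' : (m : ℝ) ≠ 0 := by exact_mod_cast hm.ne'
  have hr' : (0 : ℝ) < (r : ℝ) / m := by positivity
  have hs' : (0 : ℝ) < (s : ℝ) / m := by positivity
  unfold raceWeight progression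
  rw [Finset.sum_image fun _ _ _ _ h => progression_injective r hm h, Finset.mul_sum]
  refine Finset.sum_congr rfl fun i hi => ?_
  have hin : i ≤ n := Nat.lt_succ_iff.1 (Finset.mem_range.1 hi)
  have e := Finset.image_erase (progression_injective r hm) (Finset.range (n + 1)) i
  rw [← e, Finset.prod_image fun _ _ _ _ h => progression_injective r hm h,
    Finset.prod_image fun _ _ _ _ h => progression_injective s hm h]
  have h1 : ∏ j ∈ (Finset.range (n + 1)).erase i,
      (((r + m * j : ℕ) : ℝ) / (((r + m * j : ℕ) : ℝ) - ((r + m * i : ℕ) : ℝ))) =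
      (∏ j ∈ Finset.range (n + 1), ((r : ℝ) / m + j)) / ((r : ℝ) / m + i) /
        ((-1) ^ i * (i.factorial * (n - i).factorial)) := by
    rw [← prod_range_erase_sub hin, ← Finset.mul_prod_erase (Finset.range (n + 1)) _ hi,
      mul_div_cancel_left₀ _ (by positivity : (r : ℝ) / m + i ≠ 0), ← Finset.prod_div_distrib]
    refine Finset.prod_congr rfl fun j hj => ?_
    have hne : (j : ℝ) - i ≠ 0 := sub_ne_zero.2 (by exact_mod_cast Finset.ne_of_mem_erase hj)
    have h2 : ((r + m * j : ℕ) : ℝ) - ((r + m * i : ℕ) : ℝ) = m * ((j : ℝ) - i) := by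
      push_cast; ring
    rw [h2]
    push_cast
    field_simp
  have h3 : ∏ j ∈ Finset.range (n + 1),
      (((s + m * j : ℕ) : ℝ) / (((s + m * j : ℕ) : ℝ) + ((r + m * i : ℕ) : ℝ))) =
      (∏ j ∈ Finset.range (n + 1), ((s : ℝ) / m + j)) /
        ∏ j ∈ Finset.range (n + 1), ((r : ℝ) / m + (s : ℝ) / m + i + j) := by
    rw [← Finset.prod_div_distrib]
    refine Finset.prod_congr rfl fun j _ => ?_
    have h4 : ((s + m * j : ℕ) : ℝ) + ((r + m * i : ℕ) : ℝ) =
        m * ((r : ℝ) / m + (s : ℝ) / m + i + j) := by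
      push_cast; field_simp; ring
    have h5 : ((s + m * j : ℕ) : ℝ) = m * ((s : ℝ) / m + j) := by
      push_cast; field_simp
    rw [h4, h5, mul_div_mul_left _ _ hm']
  rw [h1, h3, Nat.cast_choose ℝ hin]
  have h6 : ((-1 : ℝ) ^ i) * (-1) ^ i = 1 := by rw [← mul_pow]; simp
  have h7 : ((-1 : ℝ) ^ i)⁻¹ = (-1) ^ i := inv_eq_of_mul_eq_one_left h6
  have h8 : (n.factorial : ℝ) ≠ 0 := by exact_mod_cast n.factorial_ne_zero
  rw [div_eq_mul_inv _ ((-1 : ℝ) ^ i * _), mul_inv, h7]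
  field_simp

/-- For `s = m` the factor `r / m + i` extends the product of `r / m + 1 + i + j` by one term at the
bottom, so each summand is proportional to a Beta value and the alternating sum collapses. -/
theorem raceWeight_progression_self {r m : ℕ} (hr : 0 < r) (hm : 0 < m) (n : ℕ) :
    raceWeight (progression r m (n + 1)) (progression m m (n + 1)) =
      (∏ j ∈ Finset.range (n + 1), ((r : ℝ) / m + j)) / n.factorial *
        ((2 * n + 1).factorial / ∏ j ∈ Finset.range (2 * n + 1 + 1), ((r : ℝ) / m + j)) := by
  have hm' : (m : ℝ) ≠ 0 := by exact_mod_cast hm.ne'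
  have hr' : (0 : ℝ) < (r : ℝ) / m := by positivity
  have h1 := sum_choose_mul_factorial_div_prod hr' n (n + 1)
  rw [raceWeight_progression hr hm hm, div_self hm', show 2 * n + 1 = n + (n + 1) by ring, ← h1,
    Finset.mul_sum, Finset.mul_sum]
  refine Finset.sum_congr rfl fun i _ => ?_
  have h2 : ∏ j ∈ Finset.range (n + 1), (1 + (j : ℝ)) = (n + 1).factorial := by
    rw [← Finset.prod_range_add_one_eq_factorial]
    push_cast
    exact Finset.prod_congr rfl fun j _ => add_comm _ _
  have h3 : ∏ j ∈ Finset.range (n + 1 + 1), ((r : ℝ) / m + i + j) =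
      ((r : ℝ) / m + i) * ∏ j ∈ Finset.range (n + 1), ((r : ℝ) / m + 1 + i + j) := by
    rw [Finset.prod_range_succ', mul_comm]
    congr 1
    · simp
    · refine Finset.prod_congr rfl fun j _ => ?_
      push_cast
      ring
  rw [h2, h3]
  ring

theorem tendsto_raceWeight_progression_self {r m : ℕ} (hr : 0 < r) (hm : 0 < m) :
    Tendsto (fun n : ℕ => raceWeight (progression r m (n + 1)) (progression m m (n + 1))) atTop
      (𝓝 (1 / (2 : ℝ) ^ ((r : ℝ) / m))) := by
  set ρ : ℝ := (r : ℝ) / m with hρ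
  have hρ0 : 0 < ρ := by positivity
  -- The closed form is this ratio times `(n / (2 * n + 1)) ^ ρ`.
  have h1 : Tendsto (fun n : ℕ => Real.GammaSeq ρ (2 * n + 1) / Real.GammaSeq ρ n) atTop (𝓝 1) := by
    have h2 : Tendsto (fun n : ℕ => 2 * n + 1) atTop atTop :=
      tendsto_atTop_mono (fun n => by omega : ∀ n : ℕ, n ≤ 2 * n + 1) tendsto_id
    have h3 := ((Real.GammaSeq_tendsto_Gamma ρ).comp h2).div (Real.GammaSeq_tendsto_Gamma ρ)
      (Real.Gamma_pos_of_pos hρ0).ne'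
    rwa [div_self (Real.Gamma_pos_of_pos hρ0).ne'] at h3
  have h4 : Tendsto (fun n : ℕ => ((n : ℝ) / (2 * n + 1)) ^ ρ) atTop (𝓝 ((1 / 2) ^ ρ)) := by
    have h5 : Tendsto (fun n : ℕ => (n : ℝ) / (2 * n + 1)) atTop (𝓝 (1 / 2)) := by
      have h6 := (tendsto_natCast_div_add_atTop (1 / 2 : ℝ)).const_mul (1 / 2)
      rw [mul_one] at h6
      refine h6.congr fun n => ?_
      have : (n : ℝ) + 1 / 2 ≠ 0 := by positivity
      field_simp
    exact h5.rpow_const (Or.inr hρ0.le)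
  have h7 := h1.mul h4
  rw [one_mul, Real.div_rpow zero_le_one zero_le_two, Real.one_rpow] at h7
  refine h7.congr' ?_
  filter_upwards [eventually_gt_atTop 0] with n hn
  rw [raceWeight_progression_self hr hm, ← hρ]
  have hn' : (0 : ℝ) < n := by exact_mod_cast hn
  have hn1 : (n : ℝ) ^ ρ ≠ 0 := (Real.rpow_pos_of_pos hn' _).ne'
  have hn2 : (2 * (n : ℝ) + 1) ^ ρ ≠ 0 := (Real.rpow_pos_of_pos (by positivity) _).ne'
  have hn3 : (n.factorial : ℝ) ≠ 0 := by exact_mod_cast n.factorial_ne_zero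
  have hp : ∀ k, ∏ j ∈ Finset.range k, (ρ + j) ≠ 0 := fun k =>
    Finset.prod_ne_zero_iff.2 fun j _ => by positivity
  have hp1 := hp (n + 1)
  have hp2 := hp (2 * n + 1 + 1)
  rw [Real.GammaSeq, Real.GammaSeq, Real.div_rpow hn'.le (by positivity)]
  push_cast
  field_simp

/-! ### The progressions and the remaining parts -/

theorem progression_pos {a m N : ℕ} (ha : 0 < a) : ∀ x ∈ progression a m N, 0 < x := by
  simp only [progression, Finset.mem_image]
  rintro x ⟨i, -, rfl⟩
  omega

theorem progression_nonempty (a m : ℕ) {N : ℕ} (hN : 1 ≤ N) : (progression a m N).Nonempty :=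
  (Finset.nonempty_range_iff.2 (by omega)).image _

theorem disjoint_progression {r s m : ℕ} (hrs : ¬ r ≡ s [MOD m]) (N : ℕ) :
    Disjoint (progression r m N) (progression s m N) := by
  rw [Finset.disjoint_left]
  simp only [progression, Finset.mem_image]
  rintro x ⟨i, -, rfl⟩ ⟨j, -, h⟩
  apply hrs
  have := congrArg (· % m) h
  simpa [Nat.ModEq] using this.symm

theorem card_biasedPartitionsIn (R S I : Finset ℕ) (n : ℕ) :
    (biasedPartitionsIn R S I n).card = biasCount R S I 0 n := by
  rw [biasedPartitionsIn, partitionsIn, Finset.filter_filter]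
  rfl

theorem card_partitionsIn (R S I : Finset ℕ) (n : ℕ) :
    (partitionsIn R S I n).card = partCount (R ∪ S ∪ I) n := rfl

theorem tendsto_biasRatio {r s m : ℕ} (hr : 0 < r) (hs : 0 < s) (hrs : ¬ r ≡ s [MOD m]) {N : ℕ}
    (hN : 1 ≤ N) :
    Tendsto (fun n : ℕ => biasRatio r s m n N) atTop
      (𝓝 (raceWeight (progression r m N) (progression s m N))) := by
  have hdisj : Disjoint (progression r m N ∪ progression s m N) (remaining r s m N) :=
    Finset.disjoint_sdiff
  have hd := Finset.disjoint_union_left.1 hdisj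
  simp only [biasRatio, card_biasedPartitionsIn, card_partitionsIn]
  refine tendsto_biasCount_div_partCount (progression_pos hr) (progression_pos hs)
    (fun x hx => ?_) (disjoint_progression hrs N) hd.1 hd.2 (progression_nonempty r m hN)
    (progression_nonempty s m hN) ?_
  · rw [remaining, Finset.mem_sdiff, Finset.mem_Icc] at hx
    omega
  · rw [remaining, Finset.union_sdiff_self_eq_union, Finset.mem_union, Finset.mem_Icc]
    exact Or.inr ⟨le_rfl, le_trans (le_trans hr (le_max_left r s)) (Nat.le_add_right _ _)⟩

theorem descPochhammer_eval_add_sub_one (ρ : ℝ) (N : ℕ) :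
    (descPochhammer ℝ N).eval (ρ + N - 1) = ∏ j ∈ Finset.range N, (ρ + j) := by
  rw [descPochhammer_eval_eq_prod_range, ← Finset.prod_range_reflect]
  refine Finset.prod_congr rfl fun j hj => ?_
  obtain ⟨k, rfl⟩ := Nat.exists_eq_add_of_lt (Finset.mem_range.1 hj)
  rw [show j + k + 1 - 1 - j = k by omega]
  push_cast
  ring

theorem intervalIntegrable_betaIntegrand {a m : ℕ} (ha : 0 < a) (hm : 0 < m) (N : ℕ) :
    IntervalIntegrable (betaIntegrand a m N) MeasureTheory.volume 0 1 :=
  intervalIntegrable_rpow_mul_one_sub_pow (by positivity) (N - 1) 0 1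

theorem intervalIntegrable_betaIntegrand_mul_integral {r s m : ℕ} (hr : 0 < r) (hs : 0 < s)
    (hm : 0 < m) (N : ℕ) :
    IntervalIntegrable
      (fun x : ℝ => betaIntegrand s m N x * ∫ t in (0 : ℝ)..x, betaIntegrand r m N t)
      MeasureTheory.volume 0 1 :=
  (intervalIntegrable_betaIntegrand hs hm N).mul_continuousOn
    (intervalIntegral.continuousOn_primitive_interval
      ((intervalIntegrable_iff').1 (intervalIntegrable_betaIntegrand hr hm N)))

theorem raceWeight_progression_eq_integral {r s m : ℕ} (hr : 0 < r) (hs : 0 < s) (hm : 0 < m)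
    {N : ℕ} (hN : 1 ≤ N) :
    raceWeight (progression r m N) (progression s m N) =
      (descPochhammer ℝ N).eval ((r : ℝ) / m + N - 1) *
          (descPochhammer ℝ N).eval ((s : ℝ) / m + N - 1) /
          ((Nat.factorial (N - 1) : ℝ) * (Nat.factorial (N - 1) : ℝ)) *
        ∫ x in (0 : ℝ)..1, betaIntegrand s m N x * ∫ t in (0 : ℝ)..x, betaIntegrand r m N t := by
  obtain ⟨n, rfl⟩ : ∃ n, N = n + 1 := ⟨N - 1, by omega⟩
  have hr' : (0 : ℝ) < (r : ℝ) / m := by positivity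
  have hs' : (0 : ℝ) < (s : ℝ) / m := by positivity
  have hn : (n.factorial : ℝ) ≠ 0 := by exact_mod_cast n.factorial_ne_zero
  simp only [betaIntegrand, Nat.add_sub_cancel]
  rw [descPochhammer_eval_add_sub_one, descPochhammer_eval_add_sub_one,
    raceWeight_progression hr hs hm, integral_beta_mul_incomplete hr' hs']
  field_simp

end PartitionBias

theorem mainTheorem6 (r s m : ℕ) (hr : 0 < r) (hs : 0 < s) (hm : 0 < m)
    (hrs : ¬ r ≡ s [MOD m]) (hgcd : Nat.gcd (Nat.gcd r s) m = 1) :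
    (∀ N : ℕ, 1 ≤ N →
      IntervalIntegrable (PartitionBias.betaIntegrand r m N) MeasureTheory.volume 0 1 ∧
      IntervalIntegrable
        (fun x : ℝ => PartitionBias.betaIntegrand s m N x *
          ∫ t in (0 : ℝ)..x, PartitionBias.betaIntegrand r m N t)
        MeasureTheory.volume 0 1 ∧
      Tendsto (fun n : ℕ => PartitionBias.biasRatio r s m n N) atTop
        (𝓝 ((descPochhammer ℝ N).eval ((r : ℝ) / m + N - 1) *
              (descPochhammer ℝ N).eval ((s : ℝ) / m + N - 1) /
              ((Nat.factorial (N - 1) : ℝ) * (Nat.factorial (N - 1) : ℝ)) *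
            ∫ x in (0 : ℝ)..1, PartitionBias.betaIntegrand s m N x *
              ∫ t in (0 : ℝ)..x, PartitionBias.betaIntegrand r m N t))) ∧
    (s = m →
      ∃ L : ℕ → ℝ,
        (∀ N : ℕ, 1 ≤ N →
          Tendsto (fun n : ℕ => PartitionBias.biasRatio r s m n N) atTop (𝓝 (L N))) ∧
        Tendsto L atTop (𝓝 (1 / (2 : ℝ) ^ ((r : ℝ) / m)))) := by
  have hlim : ∀ N : ℕ, 1 ≤ N → Tendsto (fun n : ℕ => PartitionBias.biasRatio r s m n N) atTop
      (𝓝 (PartitionBias.raceWeight (PartitionBias.progression r m N)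
        (PartitionBias.progression s m N))) :=
    fun N hN => PartitionBias.tendsto_biasRatio hr hs hrs hN
  refine ⟨fun N hN => ⟨PartitionBias.intervalIntegrable_betaIntegrand hr hm N,
    PartitionBias.intervalIntegrable_betaIntegrand_mul_integral hr hs hm N, ?_⟩, ?_⟩
  · rw [← PartitionBias.raceWeight_progression_eq_integral hr hs hm hN]
    exact hlim N hN
  · rintro rfl
    -- The shift by one matches `N = n + 1`; the value at `N = 0` plays no role.
    exact ⟨_, hlim, (tendsto_add_atTop_iff_nat 1).1
      (PartitionBias.tendsto_raceWeight_progression_self hr hm)⟩
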